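/- For every integer $\ell\ge 2$ there is a constant $C=C(\ell)>0$ such that the following holds for every integer $n\ge 1$. Let $G$ be a finite simple graph with at most $n$ vertices and at least $Cn^{3/2+1/\ell}$ edges, together with a proper edge-colouring (any two distinct edges sharing a vertex receive different colours) that uses at most $n$ colours. Then $G$ contains two vertex-disjoint cycles of length $2\ell$, each of them rainbow (its $2\ell$ edges have pairwise different colours), such that the set of colours appearing on the first cycle equals the set of colours appearing on the second. -/

import Mathlib

namespace SimpleGraph

/-- A proper edge-colouring of `G` with colours in `K`: a map from the edges of `G` to `K` that
gives different colours to any two distinct edges with a common endpoint. -/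
abbrev ProperEdgeColouring {V : Type*} (G : SimpleGraph V) (K : Type*) :=
  G.lineGraph.Coloring K

/-- The set of colours that actually occur on the edges of `G`. -/
def ProperEdgeColouring.usedColours {V K : Type*} {G : SimpleGraph V}
    (c : G.ProperEdgeColouring K) : Set K :=
  Set.range (fun e : G.edgeSet => c e)

/-- The list of colours of the edges of a walk, in the order in which the walk traverses them. -/
def Walk.colourList {V K : Type*} {G : SimpleGraph V} {u v : V}
    (p : G.Walk u v) (c : G.ProperEdgeColouring K) : List K :=
  p.darts.map (fun d => c ⟨d.edge, d.edge_mem⟩)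

/-- A walk is rainbow if its edges have pairwise different colours. -/
def Walk.IsRainbow {V K : Type*} {G : SimpleGraph V} {u v : V}
    (p : G.Walk u v) (c : G.ProperEdgeColouring K) : Prop :=
  (p.colourList c).Nodup

/-- The set of colours of the edges of a walk. -/
def Walk.colourSet {V K : Type*} {G : SimpleGraph V} {u v : V}
    (p : G.Walk u v) (c : G.ProperEdgeColouring K) : Set K :=
  {k | k ∈ p.colourList c}

end SimpleGraph

/-! Work in the auxiliary graph whose vertices are ordered pairs of distinct vertices of `G`, with
`PairRel` as adjacency: two pairs are adjacent if one colour joins them in both coordinates. A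
closed walk of length `2ℓ` there projects to two closed walks in `G` with the same colour sequence.
If its pairs are mutually disjoint and its colours are distinct, these projections are disjoint
rainbow cycles.

Cauchy–Schwarz over the colour classes (`exists_sq_le_card_pairRel`) gives the auxiliary graph
average degree at least of order `ℓ ^ 4 * T`, where `T = n ^ (2 / ℓ)`, while it has at most `n ^ 2 =
T ^ ℓ` vertices. Pass to a subset with large minimum degree `δ` and let `M` be its normalized
adjacency matrix. The closed walks of length `2ℓ`, weighted by products of entries of `M`, have
total weight `trace (M ^ (2 * ℓ)) ≥ 1`, since `M` has eigenvalue `1`. No bound on the maximum degree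
is needed.

Walks with a given conflict `a` at two given steps have weight `trace (B * M ^ p * B * M ^ q)`, with
`B` the part of `M` where `a` occurs. A Hölder-type bound reduces this to traces of `M ^ (2 * ℓ -
2)` against `B * Bᵀ` and `Bᵀ * B`. Proper colouring makes conflicts locally rare, so by the Schur
test the sum of the `B * Bᵀ` contributes `O(1 / δ) * trace (M ^ (2 * ℓ - 2))`, and
`IsSymm.trace_pow_le` absorbs the two missing steps at a cost of `2 * T`, much less than `δ`.
Conflicting walks thus weigh less than the total, and a conflict-free walk remains. -/

open Finset
open scoped Matrix

/-! ### Masked and normalized matrices, and the Schur test. -/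

namespace Matrix

variable {W : Type*}

open Classical in
/-- The matrix obtained from `M` by deleting the entries outside the relation `β`. -/
noncomputable def mask (β : W → W → Prop) (M : Matrix W W ℝ) : Matrix W W ℝ :=
  of fun u v => if β u v then M u v else 0

theorem mask_nonneg (β : W → W → Prop) {M : Matrix W W ℝ} (h : ∀ u v, 0 ≤ M u v)
    (u v : W) : 0 ≤ mask β M u v := by
  simp only [mask, of_apply]
  split_ifs
  exacts [h u v, le_rfl]

variable [Fintype W]

/-- The Schur test. -/
theorem sum_mul_mul_le_of_schur {E : Matrix W W ℝ} (hE : E.IsSymm) (h0 : ∀ u v, 0 ≤ E u v)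
    {g : W → ℝ} (hg : ∀ u, 0 < g u) {κ : ℝ} (h : ∀ u, ∑ v, E u v * g v ≤ κ * g u) (x : W → ℝ) :
    ∑ u, ∑ v, x u * E u v * x v ≤ κ * ∑ u, x u ^ 2 := by
  -- AM-GM weighted by `g`: expand `E u v * (x u * g v - x v * g u) ^ 2 ≥ 0`.
  have key : ∀ u v, x u * E u v * x v ≤
      (x u ^ 2 / g u * (E u v * g v) + x v ^ 2 / g v * (E v u * g u)) / 2 := by
    intro u v
    rw [show E v u = E u v from hE.apply u v]
    have hu := hg u
    have hv := hg v
    have h1 : 0 ≤ E u v * (x u * g v - x v * g u) ^ 2 / (g u * g v) :=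
      div_nonneg (mul_nonneg (h0 u v) (sq_nonneg _)) (by positivity)
    have h2 : E u v * (x u * g v - x v * g u) ^ 2 / (g u * g v) =
        (x u ^ 2 / g u * (E u v * g v) + x v ^ 2 / g v * (E u v * g u)) - 2 * (x u * E u v * x v) := by
      field_simp; ring
    linarith
  refine (Finset.sum_le_sum fun u _ => Finset.sum_le_sum fun v _ => key u v).trans ?_
  have e : ∑ u, ∑ v, (x u ^ 2 / g u * (E u v * g v) + x v ^ 2 / g v * (E v u * g u)) / 2 =
      ∑ u, x u ^ 2 / g u * ∑ v, E u v * g v := by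
    simp only [add_div, Finset.sum_add_distrib]
    rw [Finset.sum_comm (f := fun u v => x v ^ 2 / g v * (E v u * g u) / 2)]
    simp only [← Finset.sum_add_distrib, Finset.mul_sum]
    refine Finset.sum_congr rfl fun i _ => Finset.sum_congr rfl fun j _ => ?_
    ring
  rw [e, Finset.mul_sum]
  refine Finset.sum_le_sum fun u _ => ?_
  have hu := hg u
  calc x u ^ 2 / g u * ∑ v, E u v * g v ≤ x u ^ 2 / g u * (κ * g u) :=
        mul_le_mul_of_nonneg_left (h u) (by positivity)
    _ = κ * x u ^ 2 := by field_simp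

open Classical in
/-- The degree of a vertex with respect to a relation. -/
noncomputable def relDegree (r : W → W → Prop) (w : W) : ℝ :=
  ((univ.filter fun z => r w z).card : ℝ)

open Classical in
/-- The symmetrically normalized adjacency matrix of a relation. -/
noncomputable def normAdj (r : W → W → Prop) : Matrix W W ℝ :=
  of fun u v => if r u v then (√(relDegree r u))⁻¹ * (√(relDegree r v))⁻¹ else 0

theorem normAdj_nonneg (r : W → W → Prop) (u v : W) : 0 ≤ normAdj r u v := by
  simp only [normAdj, of_apply]
  split_ifs <;> positivity

theorem rel_of_normAdj_pos {r : W → W → Prop} {u v : W} (h : 0 < normAdj r u v) : r u v := by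
  by_contra h'
  simp [normAdj, h'] at h

theorem isSymm_normAdj {r : W → W → Prop} (hr : ∀ u v, r u v → r v u) : (normAdj r).IsSymm := by
  ext u v
  by_cases h : r u v
  · simp [normAdj, h, hr u v h, mul_comm]
  · have h' : ¬ r v u := fun h' => h (hr v u h')
    simp [normAdj, h, h']

theorem normAdj_mulVec {r : W → W → Prop} (hpos : ∀ w, 0 < relDegree r w) :
    normAdj r *ᵥ (fun w => √(relDegree r w)) = fun w => √(relDegree r w) := by
  classical
  funext u
  have hs : ∀ w, 0 < √(relDegree r w) := fun w => Real.sqrt_pos.2 (hpos w)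
  simp only [mulVec, dotProduct, normAdj, of_apply, ite_mul, zero_mul]
  have : ∀ v, (√(relDegree r u))⁻¹ * (√(relDegree r v))⁻¹ * √(relDegree r v) =
      (√(relDegree r u))⁻¹ := fun v => by
    rw [mul_assoc, inv_mul_cancel₀ (hs v).ne', mul_one]
  simp only [this]
  rw [← Finset.sum_filter, Finset.sum_const, nsmul_eq_mul]
  have h2 : ((univ.filter fun z => r u z).card : ℝ) = √(relDegree r u) * √(relDegree r u) := by
    rw [Real.mul_self_sqrt (hpos u).le, relDegree]
  rw [h2, mul_assoc, mul_inv_cancel₀ (hs u).ne', mul_one]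

/-! ### Trace inequalities for symmetric matrices. -/

variable [DecidableEq W]

theorem IsSymm.exists_orthogonal_diagonalization {M : Matrix W W ℝ} (hM : M.IsSymm) :
    ∃ (U : Matrix W W ℝ) (d : W → ℝ), Uᵀ * U = 1 ∧ U * Uᵀ = 1 ∧
      ∀ p : ℕ, M ^ p = U * diagonal (fun i => d i ^ p) * Uᵀ := by
  have hH : M.IsHermitian := by
    rw [Matrix.IsHermitian, conjTranspose_eq_transpose_of_trivial]; exact hM
  have hs := hH.spectral_theorem
  set U : Matrix W W ℝ := (hH.eigenvectorUnitary : Matrix W W ℝ) with hU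
  have hstar : star U = Uᵀ := by
    rw [star_eq_conjTranspose, conjTranspose_eq_transpose_of_trivial]
  have h1 : Uᵀ * U = 1 := by
    rw [← hstar]; exact (Unitary.mem_iff.1 hH.eigenvectorUnitary.2).1
  have h2 : U * Uᵀ = 1 := by
    rw [← hstar]; exact (Unitary.mem_iff.1 hH.eigenvectorUnitary.2).2
  refine ⟨U, hH.eigenvalues, h1, h2, fun p => ?_⟩
  have hM' : M = U * diagonal hH.eigenvalues * Uᵀ := by
    rw [Unitary.conjStarAlgAut_apply] at hs
    rw [← hstar]
    exact hs
  induction p with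
  | zero => simp [h2]
  | succ p ih =>
    rw [pow_succ, ih]
    nth_rw 2 [hM']
    calc U * diagonal (fun i => hH.eigenvalues i ^ p) * Uᵀ * (U * diagonal hH.eigenvalues * Uᵀ)
        = U * diagonal (fun i => hH.eigenvalues i ^ p) * (Uᵀ * U) * diagonal hH.eigenvalues * Uᵀ := by
          simp only [Matrix.mul_assoc]
      _ = _ := by
          rw [h1, Matrix.mul_one, Matrix.mul_assoc U, diagonal_mul_diagonal]
          simp only [pow_succ]

theorem pow_mul_pow_le_add {x y : ℝ} (hx : 0 ≤ x) (hy : 0 ≤ y) (p q : ℕ) :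
    x ^ p * y ^ q ≤ x ^ (p + q) + y ^ (p + q) := by
  rcases le_total x y with h | h
  · calc x ^ p * y ^ q ≤ y ^ p * y ^ q := by gcongr
      _ = y ^ (p + q) := (pow_add _ _ _).symm
      _ ≤ _ := le_add_of_nonneg_left (by positivity)
  · calc x ^ p * y ^ q ≤ x ^ p * x ^ q := by gcongr
      _ = x ^ (p + q) := (pow_add _ _ _).symm
      _ ≤ _ := le_add_of_nonneg_right (by positivity)

/-- This is the Hölder-type bound in an eigenbasis. The trace is the sum of `b i j * b j i * (d j ^
p * d i ^ q)`. The mixed power is at most the sum of the pure powers in absolute value, and AM-GM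
with parameter `t` separates `b i j` from `b j i`. The exponent `p + q` is even, so the pure powers
need no absolute values. -/
theorem trace_mul_diagonal_pow_le (d : W → ℝ) (b : Matrix W W ℝ) {p q m : ℕ}
    (hpq : p + q = 2 * m) {t : ℝ} (ht : 0 < t) :
    trace (b * diagonal (fun i => d i ^ p) * b * diagonal (fun i => d i ^ q)) ≤
      t * trace (diagonal (fun i => d i ^ (2 * m)) * (bᵀ * b)) +
        t⁻¹ * trace (diagonal (fun i => d i ^ (2 * m)) * (b * bᵀ)) := by
  have e1 : trace (b * diagonal (fun i => d i ^ p) * b * diagonal (fun i => d i ^ q)) =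
      ∑ i, ∑ j, b i j * b j i * (d j ^ p * d i ^ q) := by
    simp only [trace, diag_apply, mul_diagonal, Matrix.mul_apply (M := b * _), Finset.sum_mul]
    refine Finset.sum_congr rfl fun i _ => Finset.sum_congr rfl fun j _ => ?_
    ring
  have e2 : trace (diagonal (fun i => d i ^ (2 * m)) * (bᵀ * b)) =
      ∑ i, ∑ j, d i ^ (2 * m) * b j i ^ 2 := by
    simp only [trace, diag_apply, diagonal_mul, Matrix.mul_apply (M := bᵀ), Finset.mul_sum,
      transpose_apply, sq]
  have e3 : trace (diagonal (fun i => d i ^ (2 * m)) * (b * bᵀ)) =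
      ∑ i, ∑ j, d i ^ (2 * m) * b i j ^ 2 := by
    simp only [trace, diag_apply, diagonal_mul, Matrix.mul_apply (M := b), Finset.mul_sum,
      transpose_apply, sq]
  have am : ∀ x y : ℝ, |x * y| ≤ (t * x ^ 2 + t⁻¹ * y ^ 2) / 2 := by
    intro x y
    have h := sq_nonneg (t * |x| - |y|)
    have hti : t * t⁻¹ = 1 := mul_inv_cancel₀ ht.ne'
    have h2 : 0 ≤ t⁻¹ * (t * |x| - |y|) ^ 2 := by positivity
    rw [abs_mul]
    have : t⁻¹ * (t * |x| - |y|) ^ 2 = t * x ^ 2 + t⁻¹ * y ^ 2 - 2 * (|x| * |y|) := by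
      rw [← sq_abs x, ← sq_abs y]
      linear_combination (t * |x| ^ 2 - 2 * |x| * |y|) * hti
    linarith
  have key : ∀ i j, b i j * b j i * (d j ^ p * d i ^ q) ≤
      d i ^ (2 * m) * ((t * b j i ^ 2 + t⁻¹ * b i j ^ 2) / 2) +
        d j ^ (2 * m) * ((t * b i j ^ 2 + t⁻¹ * b j i ^ 2) / 2) := by
    intro i j
    have hw : ∀ i, |d i| ^ (2 * m) = d i ^ (2 * m) := fun i => (even_two_mul m).pow_abs _
    have h0 : ∀ i, 0 ≤ d i ^ (2 * m) := fun i => (even_two_mul m).pow_nonneg _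
    calc b i j * b j i * (d j ^ p * d i ^ q) ≤ |b i j * b j i * (d j ^ p * d i ^ q)| := le_abs_self _
      _ = |b i j * b j i| * (|d j| ^ p * |d i| ^ q) := by
        rw [abs_mul _ (d j ^ p * _), abs_mul (d j ^ p), abs_pow, abs_pow]
      _ ≤ |b i j * b j i| * (d j ^ (2 * m) + d i ^ (2 * m)) := by
        rw [← hw i, ← hw j, ← hpq]
        exact mul_le_mul_of_nonneg_left (pow_mul_pow_le_add (abs_nonneg _) (abs_nonneg _) _ _)
          (abs_nonneg _)
      _ ≤ _ := by
        have h1 := mul_le_mul_of_nonneg_right (am (b i j) (b j i)) (h0 j)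
        have h2 := mul_le_mul_of_nonneg_right (am (b j i) (b i j)) (h0 i)
        rw [mul_comm (b j i)] at h2
        linarith
  rw [e1, e2, e3]
  refine (Finset.sum_le_sum fun i _ => Finset.sum_le_sum fun j _ => key i j).trans_eq ?_
  simp only [Finset.sum_add_distrib]
  rw [Finset.sum_comm (f := fun i j => d j ^ (2 * m) * ((t * b i j ^ 2 + t⁻¹ * b j i ^ 2) / 2))]
  simp only [Finset.mul_sum, ← Finset.sum_add_distrib]
  refine Finset.sum_congr rfl fun i _ => Finset.sum_congr rfl fun j _ => ?_
  ring

/-- A Hölder type inequality for traces of alternating products of a matrix with powers of a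
symmetric matrix. -/
theorem IsSymm.trace_mul_pow_mul_mul_pow_le {M : Matrix W W ℝ} (hM : M.IsSymm)
    (B : Matrix W W ℝ) {p q m : ℕ} (hpq : p + q = 2 * m) {t : ℝ} (ht : 0 < t) :
    trace (B * M ^ p * B * M ^ q) ≤
      t * trace (M ^ (2 * m) * (Bᵀ * B)) + t⁻¹ * trace (M ^ (2 * m) * (B * Bᵀ)) := by
  obtain ⟨U, d, h1, h2, hpow⟩ := hM.exists_orthogonal_diagonalization
  have h := trace_mul_diagonal_pow_le d (Uᵀ * B * U) hpq ht
  have cyc : ∀ X : Matrix W W ℝ, trace (Uᵀ * X * U) = trace X := fun X => by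
    rw [trace_mul_comm, ← Matrix.mul_assoc, h2, Matrix.one_mul]
  have hconj : ∀ p, diagonal (fun i => d i ^ p) = Uᵀ * M ^ p * U := fun p => by
    rw [hpow]
    calc _ = (Uᵀ * U) * diagonal (fun i => d i ^ p) * (Uᵀ * U) := by simp [h1]
      _ = _ := by simp only [Matrix.mul_assoc]
  have mulc : ∀ X Y : Matrix W W ℝ, (Uᵀ * X * U) * (Uᵀ * Y * U) = Uᵀ * (X * Y) * U := fun X Y => by
    calc _ = Uᵀ * X * (U * Uᵀ) * Y * U := by simp only [Matrix.mul_assoc]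
      _ = _ := by rw [h2, Matrix.mul_one]; simp only [Matrix.mul_assoc]
  have ht' : (Uᵀ * B * U)ᵀ = Uᵀ * Bᵀ * U := by
    simp only [transpose_mul, transpose_transpose, Matrix.mul_assoc]
  rw [ht'] at h
  simpa only [hconj, mulc, cyc] using h

/-- Split the eigenvalues `d` at `d ^ 2 = 1 / T`. Large ones satisfy `d ^ (2 * m) ≤ T * d ^ (2 * m +
2)`; small ones contribute at most `card W * T⁻¹ ^ m ≤ T` altogether, which `h1` absorbs. -/
theorem IsSymm.trace_pow_le {M : Matrix W W ℝ} (hM : M.IsSymm) {m : ℕ} {T : ℝ} (hT : 0 < T)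
    (hW : (Fintype.card W : ℝ) ≤ T ^ (m + 1)) (h1 : 1 ≤ trace (M ^ (2 * m + 2))) :
    trace (M ^ (2 * m)) ≤ 2 * T * trace (M ^ (2 * m + 2)) := by
  obtain ⟨U, d, hU, -, hpow⟩ := hM.exists_orthogonal_diagonalization
  have htr : ∀ p, trace (M ^ p) = ∑ i, d i ^ p := fun p => by
    rw [hpow, trace_mul_comm, ← Matrix.mul_assoc, hU, Matrix.one_mul, trace_diagonal]
  have key : ∀ i, d i ^ (2 * m) ≤ T * d i ^ (2 * m + 2) + (T⁻¹) ^ m := by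
    intro i
    have h0 : 0 ≤ d i ^ (2 * m) := (even_two_mul m).pow_nonneg _
    have e : T * d i ^ (2 * m + 2) = (T * d i ^ 2) * d i ^ (2 * m) := by ring
    rcases le_total 1 (T * d i ^ 2) with h | h
    · have : 0 ≤ (T⁻¹) ^ m := by positivity
      rw [e]; nlinarith
    · have h3 : d i ^ 2 ≤ T⁻¹ := by
        rw [← one_div, le_div_iff₀ hT]; linarith
      have h4 : d i ^ (2 * m) ≤ (T⁻¹) ^ m := by
        rw [pow_mul]; gcongr
      have : 0 ≤ (T * d i ^ 2) * d i ^ (2 * m) := by positivity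
      rw [e]; linarith
  have hsum : trace (M ^ (2 * m)) ≤ T * trace (M ^ (2 * m + 2)) + Fintype.card W * (T⁻¹) ^ m := by
    rw [htr, htr, Finset.mul_sum]
    refine (Finset.sum_le_sum fun i _ => key i).trans_eq ?_
    simp [Finset.sum_add_distrib]
  have h5 : (Fintype.card W : ℝ) * (T⁻¹) ^ m ≤ T := by
    calc (Fintype.card W : ℝ) * (T⁻¹) ^ m ≤ T ^ (m + 1) * (T⁻¹) ^ m := by gcongr
      _ = T := by rw [pow_succ, mul_right_comm, ← mul_pow, mul_inv_cancel₀ hT.ne']; simp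
  nlinarith

/-- The left-hand trace is the sum of the quadratic form of `E` over the rows of `M ^ m`, so the
Schur test applies row by row. -/
theorem trace_pow_mul_le_of_schur {M E : Matrix W W ℝ} (hM : M.IsSymm) (hE : E.IsSymm)
    (h0 : ∀ u v, 0 ≤ E u v) {g : W → ℝ} (hg : ∀ u, 0 < g u) {κ : ℝ}
    (h : ∀ u, ∑ v, E u v * g v ≤ κ * g u) (m : ℕ) :
    trace (M ^ (2 * m) * E) ≤ κ * trace (M ^ (2 * m)) := by
  have hs : (M ^ m).IsSymm := hM.pow m
  have e1 : trace (M ^ (2 * m) * E) = ∑ w, ∑ u, ∑ v, (M ^ m) w u * E u v * (M ^ m) w v := by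
    rw [two_mul, pow_add, Matrix.mul_assoc, trace_mul_comm]
    simp only [trace, diag_apply, Matrix.mul_apply, Finset.sum_mul]
    refine Finset.sum_congr rfl fun w _ => ?_
    rw [Finset.sum_comm]
    refine Finset.sum_congr rfl fun u _ => Finset.sum_congr rfl fun v _ => ?_
    rw [hs.apply w v]
  have e2 : trace (M ^ (2 * m)) = ∑ w, ∑ u, (M ^ m) w u ^ 2 := by
    rw [two_mul, pow_add]
    simp only [trace, diag_apply, Matrix.mul_apply]
    refine Finset.sum_congr rfl fun w _ => Finset.sum_congr rfl fun u _ => ?_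
    rw [hs.apply w u, sq]
  rw [e1, e2, Finset.mul_sum]
  exact Finset.sum_le_sum fun w _ => sum_mul_mul_le_of_schur hE h0 hg h _

/-- If a symmetric matrix has the eigenvalue `1`, then the traces of its even powers are at
least `1`. -/
theorem one_le_trace_pow {M : Matrix W W ℝ} (hM : M.IsSymm) {g : W → ℝ} (hg : g ≠ 0)
    (h : M *ᵥ g = g) (m : ℕ) : 1 ≤ trace (M ^ (2 * m)) := by
  have hs : (M ^ m).IsSymm := hM.pow m
  have hp : (M ^ m) *ᵥ g = g := by
    induction m with
    | zero => simp
    | succ m ih => rw [pow_succ, ← mulVec_mulVec, h, ih (hM.pow m)]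
  have e2 : trace (M ^ (2 * m)) = ∑ w, ∑ u, (M ^ m) w u ^ 2 := by
    rw [two_mul, pow_add]
    simp only [trace, diag_apply, Matrix.mul_apply]
    refine Finset.sum_congr rfl fun w _ => Finset.sum_congr rfl fun u _ => ?_
    rw [hs.apply w u, sq]
  have hpos : 0 < ∑ u, g u ^ 2 := by
    obtain ⟨w, hw⟩ := Function.ne_iff.1 hg
    exact Finset.sum_pos' (fun _ _ => sq_nonneg _) ⟨w, mem_univ _, by
      have : g w ≠ 0 := hw
      positivity⟩
  -- As `g` is fixed by `M ^ m`, Cauchy–Schwarz in each row bounds its squared norm by the squared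
  -- Frobenius norm of `M ^ m` times itself.
  have h3 : ∑ w, g w ^ 2 ≤ (∑ w, ∑ u, (M ^ m) w u ^ 2) * ∑ u, g u ^ 2 := by
    rw [Finset.sum_mul]
    refine Finset.sum_le_sum fun w _ => ?_
    have hw : g w = ∑ u, (M ^ m) w u * g u := (congrFun hp w).symm
    rw [hw]
    exact Finset.sum_mul_sq_le_sq_mul_sq _ _ _
  rw [e2]
  by_contra hlt
  push Not at hlt
  nlinarith

/-! ### Traces as weighted counts of closed walks. -/

/-- The entries of a product of matrices as sums over walks. -/
theorem prod_map_range_apply (N : ℕ → Matrix W W ℝ) (m : ℕ) (u v : W) :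
    ((List.range m).map N).prod u v = ∑ x : Fin (m + 1) → W,
      if x 0 = u ∧ x (Fin.last m) = v then ∏ i : Fin m, N i (x i.castSucc) (x i.succ) else 0 := by
  induction m generalizing v with
  | zero =>
    simp only [List.range_zero, List.map_nil, List.prod_nil, Finset.univ_eq_empty,
      Finset.prod_empty]
    rw [← (Equiv.funUnique (Fin 1) W).symm.sum_comp]
    simp [Matrix.one_apply, ite_and, eq_comm]
  | succ m ih =>
    rw [List.range_succ, List.map_append, List.prod_append, Matrix.mul_apply]
    rw [← (Fin.snocEquiv (fun _ : Fin (m + 2) => W)).sum_comp, Fintype.sum_prod_type,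
      Finset.sum_comm]
    simp only [ih, Finset.sum_mul, List.map_cons, List.map_nil, List.prod_singleton]
    rw [Finset.sum_comm]
    refine Finset.sum_congr rfl fun x _ => ?_
    simp only [Fin.snocEquiv, Equiv.coe_fn_mk, Fin.prod_univ_castSucc]
    have e0 : ∀ w : W, (Fin.snoc x w : Fin (m + 2) → W) 0 = x 0 := fun w =>
      Fin.snoc_castSucc (α := fun _ => W) w x 0
    have e1 : ∀ (w : W) (i : Fin m), (Fin.snoc x w : Fin (m + 2) → W) i.castSucc.succ = x i.succ :=
      fun w i => Fin.snoc_castSucc (α := fun _ => W) w x i.succ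
    have e2 : ∀ (w : W), (Fin.snoc x w : Fin (m + 2) → W) (Fin.last m).succ = w :=
      fun w => Fin.snoc_last (α := fun _ => W) w x
    have e3 : ∀ (w : W) (i : Fin (m + 1)), (Fin.snoc x w : Fin (m + 2) → W) i.castSucc = x i :=
      fun w i => Fin.snoc_castSucc (α := fun _ => W) w x i
    have e4 : ∀ (w : W), (Fin.snoc x w : Fin (m + 2) → W) (Fin.last (m + 1)) = w :=
      fun w => Fin.snoc_last (α := fun _ => W) w x
    simp only [e0, e1, e2, e3, e4]
    by_cases hx : x 0 = u
    · simp [hx]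
    · simp [hx]

theorem trace_prod_map_range (N : ℕ → Matrix W W ℝ) (m : ℕ) :
    trace ((List.range m).map N).prod = ∑ x : Fin (m + 1) → W,
      if x 0 = x (Fin.last m) then ∏ i : Fin m, N i (x i.castSucc) (x i.succ) else 0 := by
  simp only [trace, diag_apply, prod_map_range_apply]
  rw [Finset.sum_comm]
  refine Finset.sum_congr rfl fun x _ => ?_
  by_cases h : x 0 = x (Fin.last m)
  · simp [h]
  · simp only [h, if_false]
    refine Finset.sum_eq_zero fun u _ => if_neg ?_
    rintro ⟨rfl, h'⟩
    exact h h'.symm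

theorem trace_mask_mul_pow (M : Matrix W W ℝ) {n : ℕ} {i j : Fin n} (hij : i < j) :
    ∃ p q : ℕ, p + q + 2 = n ∧ ∀ β : W → W → Prop, trace (mask β M * M ^ p * mask β M * M ^ q) =
      ∑ x : Fin (n + 1) → W, if x 0 = x (Fin.last n) then
        ∏ l : Fin n, (if l = i ∨ l = j then mask β M else M) (x l.castSucc) (x l.succ) else 0 := by
  obtain ⟨p, hp⟩ : ∃ p, (j : ℕ) = i + 1 + p := Nat.exists_eq_add_of_le (Fin.lt_def.1 hij)
  obtain ⟨q, hq⟩ : ∃ q, n = j + 1 + q := Nat.exists_eq_add_of_le j.2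
  -- By cyclicity of the trace, the `i` factors before the first masked one move to the end.
  refine ⟨p, q + i, by omega, fun β => ?_⟩
  set N : ℕ → Matrix W W ℝ := fun l => if l = i ∨ l = j then mask β M else M with hN
  have h := trace_prod_map_range N n
  have hrhs : ∀ (x : Fin (n + 1) → W) (l : Fin n),
      (if l = i ∨ l = j then mask β M else M) (x l.castSucc) (x l.succ) =
      N l (x l.castSucc) (x l.succ) := by
    intro x l
    simp only [hN, Fin.ext_iff]
  simp only [hrhs]
  rw [← h]
  have hr : List.range n = List.range i ++ [(i : ℕ)] ++ (List.range p).map (fun l : ℕ => (i : ℕ) + 1 + l) ++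
      [(j : ℕ)] ++ (List.range q).map (fun l : ℕ => (j : ℕ) + 1 + l) := by
    rw [← List.range_succ, ← List.range_add, ← hp, ← List.range_succ, ← List.range_add, ← hq]
  have hc : ∀ (f : ℕ → ℕ) (r : ℕ), (∀ l < r, f l ≠ i ∧ f l ≠ j) →
      ((List.range r).map (fun l => N (f l))).prod = M ^ r := by
    intro f r hf
    have : (List.range r).map (fun l => N (f l)) = List.replicate r M := by
      rw [List.eq_replicate_iff]
      refine ⟨by simp, ?_⟩
      intro b hb
      obtain ⟨l, hl, rfl⟩ := List.mem_map.1 hb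
      have := hf l (List.mem_range.1 hl)
      simp [hN, this.1, this.2]
    rw [this, List.prod_replicate]
  have hNi : N i = mask β M := by simp [hN]
  have hNj : N j = mask β M := by simp [hN]
  rw [hr]
  simp only [List.map_append, List.prod_append, List.map_map, List.map_cons, List.map_nil,
    List.prod_singleton, hNi, hNj]
  have c1 := hc (fun l => l) i (fun l hl => by omega)
  have c2 := hc (fun l => i + 1 + l) p (fun l hl => by omega)
  have c3 := hc (fun l => j + 1 + l) q (fun l hl => by omega)
  simp only [Function.comp_def]
  rw [c1, c2, c3, pow_add]
  simp only [Matrix.mul_assoc]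
  rw [trace_mul_comm (M ^ (i : ℕ))]
  simp only [Matrix.mul_assoc]

/-- If closed walks with a given kind of conflict between two of their steps have small weight
in total, then there is a closed walk without conflicts. -/
theorem exists_closed_walk_of_trace {J : Type*} [Fintype J] {M : Matrix W W ℝ}
    (hM : ∀ u v, 0 ≤ M u v) (β : J → W → W → Prop) {n : ℕ} {c : ℝ} (hc0 : 0 ≤ c)
    (hτ : 0 < trace (M ^ n))
    (hc : ∀ p q, p + q + 2 = n →
      ∑ a, trace (mask (β a) M * M ^ p * mask (β a) M * M ^ q) ≤ c * trace (M ^ n))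
    (hnc : (n : ℝ) ^ 2 * c < 1) :
    ∃ x : Fin (n + 1) → W, x 0 = x (Fin.last n) ∧ (∀ i : Fin n, 0 < M (x i.castSucc) (x i.succ)) ∧
      ∀ i j : Fin n, i < j → ∀ a,
        ¬ (β a (x i.castSucc) (x i.succ) ∧ β a (x j.castSucc) (x j.succ)) := by
  by_contra hno
  push Not at hno
  set wt : (Fin (n + 1) → W) → (Fin n → Matrix W W ℝ) → ℝ := fun x N =>
    if x 0 = x (Fin.last n) then ∏ l : Fin n, N l (x l.castSucc) (x l.succ) else 0 with hwt
  have htr : trace (M ^ n) = ∑ x, wt x (fun _ => M) := by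
    have := trace_prod_map_range (fun _ => M) n
    rwa [List.map_const', List.length_range, List.prod_replicate] at this
  have hwt0 : ∀ x (N : Fin n → Matrix W W ℝ), (∀ l u v, 0 ≤ N l u v) → 0 ≤ wt x N := by
    intro x N hN
    simp only [hwt]
    split_ifs
    · exact Finset.prod_nonneg fun l _ => hN l _ _
    · exact le_rfl
  set NN : J → Fin n × Fin n → Fin n → Matrix W W ℝ := fun a e l =>
    if l = e.1 ∨ l = e.2 then mask (β a) M else M with hNN
  have hNN0 : ∀ a e l u v, 0 ≤ NN a e l u v := by
    intro a e l u v
    simp only [hNN]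
    split_ifs
    · exact mask_nonneg _ hM _ _
    · exact hM _ _
  set S : Finset (Fin n × Fin n) := univ.filter fun e => e.1 < e.2 with hS
  -- Union bound: masking at the two steps of a conflict leaves the weight of the walk unchanged, so
  -- each walk of positive weight is counted on the right.
  have key : ∀ x, wt x (fun _ => M) ≤ ∑ e ∈ S, ∑ a, wt x (NN a e) := by
    intro x
    have hnn : 0 ≤ ∑ e ∈ S, ∑ a, wt x (NN a e) :=
      Finset.sum_nonneg fun e _ => Finset.sum_nonneg fun a _ => hwt0 _ _ (hNN0 a e)
    by_cases hx : x 0 = x (Fin.last n)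
    swap
    · rwa [show wt x (fun _ => M) = 0 from if_neg hx]
    by_cases hpos : ∀ i : Fin n, 0 < M (x i.castSucc) (x i.succ)
    · obtain ⟨i, j, hij, a, h1, h2⟩ := hno x hx hpos
      have hmem : (i, j) ∈ S := by simp [hS, hij]
      refine le_trans (le_of_eq ?_) ((Finset.single_le_sum
        (f := fun a => wt x (NN a (i, j))) (fun a _ => hwt0 _ _ (hNN0 a _)) (mem_univ a)).trans
        (Finset.single_le_sum (f := fun e => ∑ a, wt x (NN a e))
          (fun e _ => Finset.sum_nonneg fun a _ => hwt0 _ _ (hNN0 a e)) hmem))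
      simp only [hwt, hx, if_true]
      refine Finset.prod_congr rfl fun l _ => ?_
      simp only [hNN]
      split_ifs with hl
      · rcases hl with rfl | rfl
        · simp [mask, h1]
        · simp [mask, h2]
      · rfl
    · push Not at hpos
      obtain ⟨i, hi⟩ := hpos
      have : wt x (fun _ => M) = 0 := by
        simp only [hwt, hx, if_true]
        exact Finset.prod_eq_zero (mem_univ i) (le_antisymm hi (hM _ _))
      rw [this]; exact hnn
  have hbound : ∀ e ∈ S, ∑ x, ∑ a, wt x (NN a e) ≤ c * trace (M ^ n) := by
    intro e he
    have hlt : e.1 < e.2 := by simpa [hS] using he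
    rw [Finset.sum_comm]
    obtain ⟨i, j⟩ := e
    obtain ⟨p, q, h1, h2⟩ := trace_mask_mul_pow M hlt
    simp only [hNN, hwt, ← h2]
    exact hc p q h1
  have hfin : trace (M ^ n) ≤ (n : ℝ) ^ 2 * (c * trace (M ^ n)) := by
    calc trace (M ^ n) ≤ ∑ x, ∑ e ∈ S, ∑ a, wt x (NN a e) := by
          rw [htr]; exact Finset.sum_le_sum fun x _ => key x
      _ = ∑ e ∈ S, ∑ x, ∑ a, wt x (NN a e) := Finset.sum_comm
      _ ≤ ∑ e ∈ S, c * trace (M ^ n) := Finset.sum_le_sum hbound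
      _ = (S.card : ℝ) * (c * trace (M ^ n)) := by rw [Finset.sum_const, nsmul_eq_mul]
      _ ≤ (n : ℝ) ^ 2 * (c * trace (M ^ n)) := by
          refine mul_le_mul_of_nonneg_right ?_ (by positivity)
          have : S.card ≤ n ^ 2 := by
            refine (Finset.card_le_univ S).trans_eq ?_
            simp [sq]
          exact_mod_cast this
  nlinarith

/-! ### Conflicts carry little weight. -/

/-- Schur test with the square roots `g` of the degrees. A two-step path `u, z, v` contributes `(g
u)⁻¹ * (relDegree r z)⁻¹ ≤ (g u)⁻¹ * δ⁻¹`. Each `z` carries at most `s` conflicts, and the `g u ^ 2`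
choices of `z` give `s / δ * g u`. -/
theorem sum_trace_mask_le {J : Type*} [Fintype J] {r : W → W → Prop} (hr : ∀ u v, r u v → r v u)
    (β : J → W → W → Prop) {δ : ℝ} (hδ : 0 < δ) (hdeg : ∀ w, δ ≤ relDegree r w) {s : ℕ}
    (hs : ∀ u z, r u z → {e : J × W | r e.2 z ∧ β e.1 u z ∧ β e.1 e.2 z}.ncard ≤ s) (m : ℕ) :
    ∑ a, trace (normAdj r ^ (2 * m) * (mask (β a) (normAdj r) * (mask (β a) (normAdj r))ᵀ)) ≤
      s / δ * trace (normAdj r ^ (2 * m)) := by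
  classical
  have hpos : ∀ w, 0 < relDegree r w := fun w => hδ.trans_le (hdeg w)
  have hsq : ∀ w, 0 < √(relDegree r w) := fun w => Real.sqrt_pos.2 (hpos w)
  rw [← trace_sum, ← Matrix.mul_sum]
  set g : W → ℝ := fun w => √(relDegree r w) with hg
  refine trace_pow_mul_le_of_schur (isSymm_normAdj hr) ?_ ?_ (g := g) hsq ?_ m
  · rw [IsSymm, transpose_sum]
    simp only [transpose_mul, transpose_transpose]
  · intro u v
    rw [Matrix.sum_apply]
    refine Finset.sum_nonneg fun a _ => ?_
    rw [Matrix.mul_apply]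
    exact Finset.sum_nonneg fun z _ => mul_nonneg (mask_nonneg _ (normAdj_nonneg r) _ _)
      (mask_nonneg _ (normAdj_nonneg r) _ _)
  · intro u
    have hz : ∀ z, ∑ e : J × W, mask (β e.1) (normAdj r) u z * mask (β e.1) (normAdj r) e.2 z *
        g e.2 ≤ if r u z then s * ((g u)⁻¹ * δ⁻¹) else 0 := by
      intro z
      split_ifs with huz
      · have hterm : ∀ e : J × W, mask (β e.1) (normAdj r) u z * mask (β e.1) (normAdj r) e.2 z *
            g e.2 ≤ if r e.2 z ∧ β e.1 u z ∧ β e.1 e.2 z then (g u)⁻¹ * δ⁻¹ else 0 := by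
          intro e
          simp only [mask, normAdj, of_apply, huz, if_true]
          by_cases h1 : r e.2 z <;> by_cases h2 : β e.1 u z <;> by_cases h3 : β e.1 e.2 z <;>
            simp only [h1, h2, h3, if_true, if_false, and_self, and_true, and_false,
              mul_zero, zero_mul, le_refl]
          have hgz : g z * g z = relDegree r z := Real.mul_self_sqrt (hpos z).le
          have : (√(relDegree r u))⁻¹ * (√(relDegree r z))⁻¹ *
              ((√(relDegree r e.2))⁻¹ * (√(relDegree r z))⁻¹) * g e.2 =
              (g u)⁻¹ * (relDegree r z)⁻¹ := by
            have h4 : 0 < g e.2 := hsq e.2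
            calc _ = (g u)⁻¹ * (g z * g z)⁻¹ * ((g e.2)⁻¹ * g e.2) := by
                  rw [mul_inv]; simp only [hg]; ring
              _ = _ := by rw [inv_mul_cancel₀ h4.ne', mul_one, hgz]
          rw [this]
          have := hsq u
          have : 0 < g u := this
          gcongr
          exact hdeg z
        refine (Finset.sum_le_sum fun e _ => hterm e).trans ?_
        rw [← Finset.sum_filter, Finset.sum_const, nsmul_eq_mul]
        have h0 : 0 ≤ (g u)⁻¹ * δ⁻¹ := by positivity
        refine mul_le_mul_of_nonneg_right ?_ h0
        have := hs u z huz
        rw [Set.ncard_eq_toFinset_card', Set.toFinset_ofPred] at this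
        exact_mod_cast this
      · refine le_of_eq (Finset.sum_eq_zero fun e _ => ?_)
        simp [mask, normAdj, huz]
    have hre : ∑ v, (∑ a, mask (β a) (normAdj r) * (mask (β a) (normAdj r))ᵀ) u v * g v =
        ∑ z, ∑ e : J × W, mask (β e.1) (normAdj r) u z * mask (β e.1) (normAdj r) e.2 z *
        g e.2 := by
      simp only [Matrix.sum_apply, Matrix.mul_apply, transpose_apply, Finset.sum_mul]
      rw [Finset.sum_comm (s := (univ : Finset W)) (t := (univ : Finset (J × W)))]
      rw [Fintype.sum_prod_type, Finset.sum_comm]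
    rw [hre]
    refine (Finset.sum_le_sum fun z _ => hz z).trans ?_
    rw [← Finset.sum_filter, Finset.sum_const, nsmul_eq_mul]
    have h2 : ((univ.filter fun z => r u z).card : ℝ) = g u * g u := by
      rw [Real.mul_self_sqrt (hpos u).le, relDegree]
    rw [h2]
    have h6 : 0 < g u := hsq u
    refine le_of_eq ?_
    field_simp

/-- A mask on the starting vertex is a diagonal projection times `M`, so cyclicity turns each trace
into the part of `trace (M ^ (2 * m + 2))` at vertices with label `a`. There is no gain of `1 / δ`
here; the parameter `t` of the Hölder-type bound compensates for that. -/
theorem sum_trace_transpose_mask_mul_le {J : Type*} [Fintype J] {M : Matrix W W ℝ} (hM : M.IsSymm)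
    (h0 : ∀ u v, 0 ≤ M u v) (q : J → W → Prop) {s : ℕ} (hq : ∀ w, {a | q a w}.ncard ≤ s) (m : ℕ) :
    ∑ a, trace (M ^ (2 * m) * ((mask (fun u _ => q a u) M)ᵀ * mask (fun u _ => q a u) M)) ≤
      s * trace (M ^ (2 * m + 2)) := by
  classical
  have hd : ∀ a, mask (fun u _ => q a u) M = diagonal (fun u => if q a u then (1 : ℝ) else 0) * M := by
    intro a
    ext u v
    simp [mask, diagonal_mul]
  have hpow : ∀ n w, 0 ≤ (M ^ n) w w := by
    intro n
    suffices ∀ u v, 0 ≤ (M ^ n) u v from fun w => this w w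
    induction n with
    | zero => intro u v; simp only [pow_zero, Matrix.one_apply]; split_ifs <;> simp
    | succ n ih =>
      intro u v
      rw [pow_succ, Matrix.mul_apply]
      exact Finset.sum_nonneg fun z _ => mul_nonneg (ih _ _) (h0 _ _)
  have hterm : ∀ a, trace (M ^ (2 * m) * ((mask (fun u _ => q a u) M)ᵀ *
      mask (fun u _ => q a u) M)) = ∑ w, if q a w then (M ^ (2 * m + 2)) w w else 0 := by
    intro a
    rw [hd, transpose_mul, diagonal_transpose, hM.eq]
    set D : Matrix W W ℝ := diagonal (fun u => if q a u then (1 : ℝ) else 0) with hD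
    have hDD : D * D = D := by
      rw [hD, diagonal_mul_diagonal]
      congr 1
      funext u
      split_ifs <;> simp
    calc trace (M ^ (2 * m) * (M * D * (D * M)))
        = trace (M ^ (2 * m) * M * (D * D) * M) := by simp only [Matrix.mul_assoc]
      _ = trace (D * (M * M ^ (2 * m) * M)) := by
          rw [hDD, trace_mul_comm, trace_mul_comm D]
          simp only [Matrix.mul_assoc]
      _ = trace (D * M ^ (2 * m + 2)) := by rw [← pow_succ', ← pow_succ]
      _ = _ := by
          simp [hD, trace, diagonal_mul]
  simp only [hterm]
  rw [Finset.sum_comm, trace, Finset.mul_sum]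
  refine Finset.sum_le_sum fun w _ => ?_
  rw [← Finset.sum_filter, Finset.sum_const, nsmul_eq_mul]
  refine mul_le_mul_of_nonneg_right ?_ (hpow _ _)
  have := hq w
  rw [Set.ncard_eq_toFinset_card', Set.toFinset_ofPred] at this
  exact_mod_cast this

/-- A relation in which all degrees are large compared to a root of the number of vertices has
closed walks whose vertices have pairwise different labels and whose steps have pairwise
different colours, provided that labels and colours are locally sparse. -/
theorem exists_conflict_free_closed_walk [Nonempty W] {I K : Type*} [Fintype I] [Fintype K]
    {r : W → W → Prop} (hr : ∀ u v, r u v → r v u) (q : I → W → Prop) (R : K → W → W → Prop)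
    (hRsymm : ∀ k u v, R k u v → R k v u) (hq : ∀ w, {a | q a w}.ncard ≤ 2)
    (hq' : ∀ u z, r u z → {e : I × W | r e.2 z ∧ q e.1 u ∧ q e.1 e.2}.ncard ≤ 4)
    (hR : ∀ u z, r u z → {e : K × W | r e.2 z ∧ R e.1 u z ∧ R e.1 e.2 z}.ncard ≤ 1)
    {k : ℕ} (hk : 1 ≤ k) {T : ℝ} (hT : 0 < T) (hW : (Fintype.card W : ℝ) ≤ T ^ k)
    (hdeg : ∀ w, (100 * (k : ℝ) ^ 2) ^ 2 * T ≤ relDegree r w) :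
    ∃ x : Fin (2 * k + 1) → W, x 0 = x (Fin.last (2 * k)) ∧
      (∀ i : Fin (2 * k), r (x i.castSucc) (x i.succ)) ∧
      ∀ i j : Fin (2 * k), i < j →
        (∀ a, ¬ (q a (x i.castSucc) ∧ q a (x j.castSucc))) ∧
        ∀ κ, ¬ (R κ (x i.castSucc) (x i.succ) ∧ R κ (x j.castSucc) (x j.succ)) := by
  obtain ⟨m, rfl⟩ : ∃ m, k = m + 1 := ⟨k - 1, by omega⟩
  set kk : ℝ := ((m + 1 : ℕ) : ℝ) with hkk
  have hk1 : (1 : ℝ) ≤ kk := by rw [hkk]; exact_mod_cast hk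
  set δ : ℝ := (100 * kk ^ 2) ^ 2 * T with hδ
  have hδ0 : 0 < δ := by positivity
  have hpos : ∀ w, 0 < relDegree r w := fun w => hδ0.trans_le (hdeg w)
  set M := normAdj r with hMdef
  have hM : M.IsSymm := isSymm_normAdj hr
  have hτ : 1 ≤ trace (M ^ (2 * m + 2)) := by
    obtain ⟨w⟩ := ‹Nonempty W›
    exact one_le_trace_pow hM (fun h => (Real.sqrt_pos.2 (hpos w)).ne' (congrFun h w))
      (normAdj_mulVec hpos) (m + 1)
  set τ := trace (M ^ (2 * m + 2)) with hτdef
  have hsmall : trace (M ^ (2 * m)) ≤ 2 * T * τ := hM.trace_pow_le hT hW hτ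
  have hdiv : ∀ s : ℝ, 0 ≤ s → s / δ * trace (M ^ (2 * m)) ≤ 2 * s / (100 * kk ^ 2) ^ 2 * τ := by
    intro s hs
    calc s / δ * trace (M ^ (2 * m)) ≤ s / δ * (2 * T * τ) := by gcongr
      _ = 2 * s / (100 * kk ^ 2) ^ 2 * τ := by rw [hδ]; field_simp
  -- Over at most `(2 * kk) ^ 2` pairs of steps, the term `2 * t` costs `1 / 2`, and the `t⁻¹` term,
  -- which has the gain from `δ`, costs `512 / 10000`.
  set t : ℝ := (16 * kk ^ 2)⁻¹ with ht
  have ht0 : 0 < t := by positivity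
  have hvert : ∀ a b, a + b = 2 * m →
      ∑ i, trace (mask (fun u _ => q i u) M * M ^ a * mask (fun u _ => q i u) M * M ^ b) ≤
        (2 * t + t⁻¹ * (8 / (100 * kk ^ 2) ^ 2)) * τ := by
    intro a b hab
    have h1 := sum_trace_transpose_mask_mul_le hM (normAdj_nonneg r) q hq m
    have h2 := (sum_trace_mask_le hr (fun i u _ => q i u) hδ0 hdeg hq' m).trans
      (hdiv _ (by positivity))
    refine (Finset.sum_le_sum fun i _ => hM.trace_mul_pow_mul_mul_pow_le _ hab ht0).trans ?_
    rw [Finset.sum_add_distrib, ← Finset.mul_sum, ← Finset.mul_sum]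
    calc _ ≤ t * ((2 : ℕ) * τ) + t⁻¹ * (2 * ((4 : ℕ) : ℝ) / (100 * kk ^ 2) ^ 2 * τ) := by gcongr
      _ = _ := by push_cast; ring
  have hcol : ∀ a b, a + b = 2 * m →
      ∑ i, trace (mask (R i) M * M ^ a * mask (R i) M * M ^ b) ≤
        (4 / (100 * kk ^ 2) ^ 2) * τ := by
    intro a b hab
    have h2 := (sum_trace_mask_le hr R hδ0 hdeg hR m).trans (hdiv _ (by positivity))
    have hsymm : ∀ i, (mask (R i) M)ᵀ = mask (R i) M := by
      intro i
      ext u v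
      by_cases h : R i u v
      · simp [mask, h, hRsymm i u v h, hM.apply u v]
      · have h' : ¬ R i v u := fun h' => h (hRsymm i v u h')
        simp [mask, h, h']
    refine (Finset.sum_le_sum fun i _ => hM.trace_mul_pow_mul_mul_pow_le _ hab one_pos).trans ?_
    rw [← hMdef] at h2
    simp only [hsymm] at h2 ⊢
    rw [Finset.sum_add_distrib, ← Finset.mul_sum, ← Finset.mul_sum]
    calc _ ≤ 1 * (2 * ((1 : ℕ) : ℝ) / (100 * kk ^ 2) ^ 2 * τ) +
          1⁻¹ * (2 * ((1 : ℕ) : ℝ) / (100 * kk ^ 2) ^ 2 * τ) := by gcongr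
      _ = _ := by push_cast; ring
  obtain ⟨x, hx, hstep, hconf⟩ := exists_closed_walk_of_trace (n := 2 * (m + 1))
    (normAdj_nonneg r) (Sum.elim (fun i u _ => q i u) R)
    (c := (2 * t + t⁻¹ * (8 / (100 * kk ^ 2) ^ 2)) + (4 / (100 * kk ^ 2) ^ 2)) (by positivity)
    (lt_of_lt_of_le one_pos hτ) (by
      intro a b hab
      rw [Fintype.sum_sum_type, add_mul]
      exact add_le_add (hvert a b (by omega)) (hcol a b (by omega))) (by
      have e1 : ((2 * (m + 1) : ℕ) : ℝ) = 2 * kk := by rw [hkk]; push_cast; ring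
      rw [e1, ht]
      have h1 : (2 * kk) ^ 2 * (2 * (16 * kk ^ 2)⁻¹ + (16 * kk ^ 2)⁻¹⁻¹ * (8 / (100 * kk ^ 2) ^ 2) +
          4 / (100 * kk ^ 2) ^ 2) = 1 / 2 + 512 / 10000 + 16 / 10000 / kk ^ 2 := by
        field_simp
        ring
      rw [h1]
      have h2 : 16 / 10000 / kk ^ 2 ≤ 16 / 10000 := by
        refine div_le_self (by norm_num) ?_
        nlinarith
      linarith)
  exact ⟨x, hx, fun i => rel_of_normAdj_pos (hstep i), fun i j hij =>
    ⟨fun a => hconf i j hij (Sum.inl a), fun κ => hconf i j hij (Sum.inr κ)⟩⟩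

end Matrix

/-! ### Passing to large minimum degree. -/

open Classical in
/-- A finite symmetric relation of large average degree has a restriction of large minimum
degree. -/
theorem Finset.exists_subset_forall_le_card_filter {α : Type*} {r : α → α → Prop}
    (hr : ∀ u v, r u v → r v u) {S₀ : Finset α} (hS₀ : S₀.Nonempty) {d : ℝ}
    (hd : 2 * d * S₀.card ≤ (((S₀ ×ˢ S₀).filter fun e => r e.1 e.2).card : ℝ)) :
    ∃ S ⊆ S₀, S.Nonempty ∧ ∀ w ∈ S, d ≤ ((S.filter fun z => r w z).card : ℝ) := by
  obtain ⟨S, hS, hmin⟩ := exists_min_image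
    (S₀.powerset.filter fun S => S.Nonempty ∧
      2 * d * S.card ≤ (((S ×ˢ S).filter fun e => r e.1 e.2).card : ℝ)) card
    ⟨S₀, by simpa using ⟨hS₀, hd⟩⟩
  simp only [mem_filter, mem_powerset] at hS hmin
  refine ⟨S, hS.1, hS.2.1, fun w hw => ?_⟩
  by_contra hlt
  push Not at hlt
  have hsub : (S ×ˢ S).filter (fun e => r e.1 e.2) ⊆
      (((S.erase w) ×ˢ (S.erase w)).filter fun e => r e.1 e.2) ∪
        ((S.filter fun z => r w z).image (fun z => (w, z)) ∪
          (S.filter fun z => r w z).image (fun z => (z, w))) := by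
    rintro ⟨a, b⟩ h
    simp only [mem_filter, mem_product, mem_union, mem_image, mem_erase, Prod.mk.injEq] at h ⊢
    by_cases ha : a = w
    · subst ha; exact Or.inr (Or.inl ⟨b, ⟨h.1.2, h.2⟩, rfl, rfl⟩)
    · by_cases hb : b = w
      · subst hb; exact Or.inr (Or.inr ⟨a, ⟨h.1.1, hr _ _ h.2⟩, rfl, rfl⟩)
      · exact Or.inl ⟨⟨⟨ha, h.1.1⟩, hb, h.1.2⟩, h.2⟩
  have hcard : ((S ×ˢ S).filter (fun e => r e.1 e.2)).card ≤
      (((S.erase w) ×ˢ (S.erase w)).filter fun e => r e.1 e.2).card +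
        ((S.filter fun z => r w z).card + (S.filter fun z => r w z).card) :=
    (card_le_card hsub).trans ((card_union_le _ _).trans (Nat.add_le_add_left
      ((card_union_le _ _).trans (Nat.add_le_add card_image_le card_image_le)) _))
  have hcard' : (((S ×ˢ S).filter (fun e => r e.1 e.2)).card : ℝ) ≤
      (((S.erase w) ×ˢ (S.erase w)).filter fun e => r e.1 e.2).card +
        ((S.filter fun z => r w z).card + (S.filter fun z => r w z).card) := by
    exact_mod_cast hcard
  have he : (S.card : ℝ) = (S.erase w).card + 1 := by
    exact_mod_cast (card_erase_add_one hw).symm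
  have hS3 := hS.2.2
  rw [he] at hS3
  -- Deleting `w` loses fewer than `2 * d` ordered pairs, so the density survives, against
  -- minimality. Strictness excludes an empty `S.erase w`.
  have hgt : 2 * d * (S.erase w).card <
      ((((S.erase w) ×ˢ (S.erase w)).filter fun e => r e.1 e.2).card : ℝ) := by linarith
  rcases (S.erase w).eq_empty_or_nonempty with h0 | hne
  · simp [h0] at hgt
  · have := hmin (S.erase w) ⟨(erase_subset _ _).trans hS.1, hne, hgt.le⟩
    exact absurd (card_erase_lt_of_mem hw) (not_lt.2 this)

/-! ### The pair relation of a properly coloured graph. -/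

namespace SimpleGraph

variable {V K : Type*} {G : SimpleGraph V}

/-- The relation "`u` and `v` are joined by an edge of colour `k`". -/
def ProperEdgeColouring.Rel (c : G.ProperEdgeColouring K) (k : K) (u v : V) : Prop :=
  ∃ h : G.Adj u v, c ⟨s(u, v), h⟩ = k

namespace ProperEdgeColouring

variable {c : G.ProperEdgeColouring K}

theorem Rel.symm {k : K} {u v : V} (h : c.Rel k u v) : c.Rel k v u := by
  obtain ⟨h, rfl⟩ := h
  refine ⟨h.symm, ?_⟩
  congr 1
  exact Subtype.ext Sym2.eq_swap

theorem Rel.right_unique {k : K} {u v w : V} (h : c.Rel k u v) (h' : c.Rel k u w) : v = w := by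
  obtain ⟨h, rfl⟩ := h
  obtain ⟨h', he⟩ := h'
  by_contra hne
  refine c.valid (v := ⟨s(u, w), h'⟩) (w := ⟨s(u, v), h⟩) ?_ he
  rw [lineGraph_adj_iff_exists]
  refine ⟨fun heq => hne ?_, u, by simp, by simp⟩
  have := congrArg Subtype.val heq
  exact (Sym2.congr_right.1 this).symm

theorem Rel.left_unique {k : K} {u v w : V} (h : c.Rel k v u) (h' : c.Rel k w u) : v = w :=
  h.symm.right_unique h'.symm

theorem Rel.colour_unique {k k' : K} {u v : V} (h : c.Rel k u v) (h' : c.Rel k' u v) : k = k' := by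
  obtain ⟨_, rfl⟩ := h
  obtain ⟨_, rfl⟩ := h'
  rfl

theorem Rel.mem_usedColours {k : K} {u v : V} (h : c.Rel k u v) : k ∈ c.usedColours := by
  obtain ⟨h, rfl⟩ := h
  exact ⟨_, rfl⟩

/-- Two pairs of vertices are related if they are joined coordinatewise by edges of the same
colour. -/
def PairRel (c : G.ProperEdgeColouring K) (p q : V × V) : Prop :=
  ∃ k, c.Rel k p.1 q.1 ∧ c.Rel k p.2 q.2

theorem PairRel.symm {p q : V × V} (h : c.PairRel p q) : c.PairRel q p := by
  obtain ⟨k, h1, h2⟩ := h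
  exact ⟨k, h1.symm, h2.symm⟩

-- Two oriented edges of the same colour give a related pair of vertex pairs, from which the edges
-- and the colour can be recovered. If their starting points agree, properness makes the edges
-- equal; this accounts for the linear term. Otherwise properness makes their endpoints differ too.
open Classical in
theorem sum_sq_le_card_pairRel [Fintype V] (c : G.ProperEdgeColouring K)
    (s : Finset K) :
    ∑ k ∈ s, ((univ.filter fun p : V × V => c.Rel k p.1 p.2).card) ^ 2 ≤
      (((univ : Finset V).offDiag ×ˢ (univ : Finset V).offDiag).filter
        fun e => c.PairRel e.1 e.2).card +
      ∑ k ∈ s, (univ.filter fun p : V × V => c.Rel k p.1 p.2).card := by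
  set M : K → Finset (V × V) := fun k => univ.filter fun p : V × V => c.Rel k p.1 p.2 with hM
  have hmem : ∀ k p, p ∈ M k ↔ c.Rel k p.1 p.2 := fun k p => by simp [hM]
  have h1 : ∀ k ∈ s, (M k).card ^ 2 ≤ ((M k ×ˢ M k).filter fun e => e.1.1 ≠ e.2.1).card +
      (M k).card := by
    intro k _
    have hsplit := card_filter_add_card_filter_not (s := M k ×ˢ M k) (fun e => e.1.1 = e.2.1)
    rw [card_product, ← sq] at hsplit
    have hdiag : ((M k ×ˢ M k).filter fun e => e.1.1 = e.2.1).card ≤ (M k).card := by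
      refine card_le_card_of_injOn Prod.fst (fun e he => ?_) ?_
      · exact (mem_product.1 (mem_filter.1 he).1).1
      · rintro ⟨⟨a, b⟩, ⟨a1, b1⟩⟩ h ⟨⟨a', b'⟩, ⟨a1', b1'⟩⟩ h' heq
        simp only [coe_filter, mem_product, hmem, Set.mem_ofPred_eq] at h h'
        obtain ⟨⟨h1, h2⟩, rfl⟩ := h
        obtain ⟨⟨h1', h2'⟩, rfl⟩ := h'
        simp only [Prod.mk.injEq] at heq
        obtain ⟨rfl, rfl⟩ := heq
        rw [h2.right_unique h2']
    simp only [ne_eq]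
    omega
  refine (Finset.sum_le_sum h1).trans ?_
  rw [Finset.sum_add_distrib]
  refine Nat.add_le_add_right ?_ _
  rw [← card_sigma]
  refine card_le_card_of_injOn
    (fun e => ((e.2.1.1, e.2.2.1), (e.2.1.2, e.2.2.2))) (fun e he => ?_) ?_
  · obtain ⟨k, ⟨a, b⟩, ⟨a', b'⟩⟩ := e
    simp only [coe_sigma, Set.mem_sigma_iff, coe_filter, mem_product, hmem,
      Set.mem_ofPred_eq] at he
    obtain ⟨-, ⟨h1, h2⟩, hne⟩ := he
    simp only [coe_filter, mem_product, mem_offDiag, mem_univ, true_and, Set.mem_ofPred_eq]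
    refine ⟨⟨hne, fun h => hne ?_⟩, k, h1, h2⟩
    subst h
    exact h1.left_unique h2
  · rintro ⟨k, ⟨a, b⟩, ⟨a', b'⟩⟩ h ⟨k1, ⟨a1, b1⟩, ⟨a1', b1'⟩⟩ h' heq
    simp only [coe_sigma, Set.mem_sigma_iff, coe_filter, mem_product, hmem,
      Set.mem_ofPred_eq] at h h'
    simp only [Prod.mk.injEq] at heq
    obtain ⟨⟨rfl, rfl⟩, rfl, rfl⟩ := heq
    obtain rfl := h.2.1.1.colour_unique h'.2.1.1
    rfl

open Classical in
theorem two_mul_ncard_edgeSet_le_sum [Fintype V] (c : G.ProperEdgeColouring K) {s : Finset K}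
    (hs : c.usedColours ⊆ s) :
    2 * G.edgeSet.ncard ≤ ∑ k ∈ s, (univ.filter fun p : V × V => c.Rel k p.1 p.2).card := by
  have h1 : 2 * G.edgeSet.ncard = (univ.filter fun p : V × V => G.Adj p.1 p.2).card := by
    rw [← coe_edgeFinset, Set.ncard_coe_finset, ← sum_degrees_eq_twice_card_edges]
    rw [card_filter, Fintype.sum_prod_type]
    refine Finset.sum_congr rfl fun u _ => ?_
    rw [← card_neighborFinset_eq_degree, neighborFinset_eq_filter, card_filter]
  rw [h1]
  refine (card_le_card ?_).trans card_biUnion_le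
  rintro ⟨u, v⟩ h
  simp only [mem_filter, mem_univ, true_and, mem_biUnion] at h ⊢
  have hr : c.Rel (c ⟨s(u, v), h⟩) u v := ⟨h, rfl⟩
  exact ⟨_, hs hr.mem_usedColours, hr⟩

end ProperEdgeColouring

/-! ### Rainbow cycles from vertex and colour sequences. -/

theorem exists_walk_of_rel (c : G.ProperEdgeColouring K) (f : ℕ → V) (κ : ℕ → K) (m : ℕ)
    (h : ∀ i < m, c.Rel (κ i) (f i) (f (i + 1))) :
    ∃ p : G.Walk (f 0) (f m), p.length = m ∧ p.support = (List.range (m + 1)).map f ∧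
      p.colourList c = (List.range m).map κ := by
  induction m with
  | zero => exact ⟨Walk.nil, rfl, rfl, rfl⟩
  | succ m ih =>
    obtain ⟨p, h1, h2, h3⟩ := ih fun i hi => h i (hi.trans m.lt_succ_self)
    obtain ⟨ha, hk⟩ := h m m.lt_succ_self
    refine ⟨p.concat ha, by simp [h1], ?_, ?_⟩
    · rw [Walk.support_concat, h2, List.range_succ (n := m + 1)]
      simp
    · rw [Walk.colourList, Walk.darts_concat, List.range_succ, List.map_append, ← h3,
        Walk.colourList]
      simp [← hk, Dart.edge]

/-- Distinct colours already force distinct edges, so the walk is a trail and no bound `3 ≤ m` is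
required. -/
theorem exists_rainbow_cycle_of_rel (c : G.ProperEdgeColouring K) (f : ℕ → V) (κ : ℕ → K) {m : ℕ}
    (hm : m ≠ 0) (h : ∀ i < m, c.Rel (κ i) (f i) (f (i + 1))) (hf : f m = f 0)
    (hinj : ∀ i j, i < j → j < m → f i ≠ f j) (hκ : ∀ i j, i < j → j < m → κ i ≠ κ j) :
    ∃ p : G.Walk (f 0) (f 0), p.IsCycle ∧ p.length = m ∧ p.IsRainbow c ∧
      p.support = (List.range (m + 1)).map f ∧ p.colourList c = (List.range m).map κ := by
  obtain ⟨p, h1, h2, h3⟩ := exists_walk_of_rel c f κ m h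
  generalize hv : f m = v at p
  have hv0 : v = f 0 := hv.symm.trans hf
  subst hv0
  have hrain : p.IsRainbow c := by
    rw [Walk.IsRainbow, h3]
    refine List.Nodup.map_on (fun i hi j hj hij => ?_) List.nodup_range
    rw [List.mem_range] at hi hj
    rcases lt_trichotomy i j with hlt | heq | hgt
    · exact absurd hij (hκ i j hlt hj)
    · exact heq
    · exact absurd hij.symm (hκ j i hgt hi)
  refine ⟨p, ?_, h1, hrain, h2, h3⟩
  rw [Walk.isCycle_def]
  refine ⟨?_, ?_, ?_⟩
  · rw [Walk.isTrail_def, Walk.edges]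
    have hsub : ∀ d ∈ p.darts, ∀ d' ∈ p.darts, d.edge = d'.edge →
        c ⟨d.edge, d.edge_mem⟩ = c ⟨d'.edge, d'.edge_mem⟩ := by
      intro d _ d' _ he
      congr 1
      exact Subtype.ext he
    rw [Walk.IsRainbow, Walk.colourList, List.Nodup, List.pairwise_map] at hrain
    rw [List.Nodup, List.pairwise_map]
    refine hrain.imp_of_mem fun hd hd' hne he => hne (hsub _ hd _ hd' he)
  · rintro rfl
    exact hm (by simpa using h1.symm)
  · rw [h2, List.range_succ_eq_map, List.map_cons, List.tail_cons, List.map_map]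
    refine List.Nodup.map_on (fun i hi j hj hij => ?_) List.nodup_range
    rw [List.mem_range] at hi hj
    have key : ∀ i j, i < j → j < m → f (i + 1) ≠ f (j + 1) := by
      intro i j hij hj
      rcases Nat.lt_or_ge (j + 1) m with hlt | hge
      · exact hinj _ _ (by omega) hlt
      · have : j + 1 = m := by omega
        rw [this, hv]
        exact (hinj 0 (i + 1) (by omega) (by omega)).symm
    rcases lt_trichotomy i j with hlt | heq | hgt
    · exact absurd hij (key i j hlt hj)
    · exact heq
    · exact absurd hij.symm (key j i hgt hi)

/-! ### From edge density to the two cycles. -/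

namespace ProperEdgeColouring

theorem finite_usedColours [Finite V] (c : G.ProperEdgeColouring K) : c.usedColours.Finite :=
  Set.finite_range _

open Classical in
theorem exists_sq_le_card_pairRel [Fintype V] (c : G.ProperEdgeColouring K) {n : ℕ}
    (hn : c.usedColours.ncard ≤ n) :
    ∃ D : ℝ, 2 * (G.edgeSet.ncard : ℝ) ≤ D ∧
      D ^ 2 ≤ n * ((((univ : Finset V).offDiag ×ˢ (univ : Finset V).offDiag).filter
        fun e => c.PairRel e.1 e.2).card + D) := by
  set s : Finset K := c.finite_usedColours.toFinset with hs
  have hscard : (s.card : ℝ) ≤ n := by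
    rw [Set.ncard_eq_toFinset_card _ c.finite_usedColours] at hn
    exact_mod_cast hn
  refine ⟨∑ k ∈ s, ((univ.filter fun p : V × V => c.Rel k p.1 p.2).card : ℝ), ?_, ?_⟩
  · exact_mod_cast two_mul_ncard_edgeSet_le_sum c (s := s) (by simp [hs])
  · refine sq_sum_le_card_mul_sum_sq.trans (mul_le_mul hscard ?_ ?_ (by positivity))
    · exact_mod_cast sum_sq_le_card_pairRel c s
    · exact Finset.sum_nonneg fun _ _ => sq_nonneg _

/-- A set of pairs of distinct vertices in which the pair relation has large minimum degree
contains a closed walk that gives two vertex-disjoint rainbow cycles with the same colours. -/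
theorem exists_cycles_of_le_card_filter_pairRel [Fintype V] (c : G.ProperEdgeColouring K) {ℓ : ℕ}
    (hℓ : 1 ≤ ℓ) {S : Finset (V × V)} (hS : S.Nonempty) (hne : ∀ p ∈ S, p.1 ≠ p.2)
    {T : ℝ} (hT : 0 < T) (hcard : (S.card : ℝ) ≤ T ^ ℓ)
    (hdeg : ∀ p ∈ S,
      (100 * (ℓ : ℝ) ^ 2) ^ 2 * T ≤ (({q ∈ (S : Set (V × V)) | c.PairRel p q}.ncard : ℕ) : ℝ)) :
    ∃ (u v : V) (p : G.Walk u u) (q : G.Walk v v),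
      p.IsCycle ∧ p.length = 2 * ℓ ∧ p.IsRainbow c ∧
      q.IsCycle ∧ q.length = 2 * ℓ ∧ q.IsRainbow c ∧
      p.support.Disjoint q.support ∧ p.colourSet c = q.colourSet c := by
  classical
  have : Fintype c.usedColours := c.finite_usedColours.fintype
  have : Nonempty S := hS.to_subtype
  obtain ⟨x, hx, hstep, hconf⟩ := Matrix.exists_conflict_free_closed_walk (W := S)
    (r := fun p q => c.PairRel p.1 q.1) (fun _ _ h => h.symm)
    (fun (a : V) p => p.1.1 = a ∨ p.1.2 = a)
    (fun (k : c.usedColours) p q => c.Rel k p.1.1 q.1.1 ∧ c.Rel k p.1.2 q.1.2)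
    (fun _ _ _ h => ⟨h.1.symm, h.2.symm⟩)
    (by
      intro w
      refine (Set.ncard_le_ncard (t := {w.1.1, w.1.2}) ?_ (Set.toFinite _)).trans
        ((Set.ncard_insert_le _ _).trans (by simp))
      rintro a (rfl | rfl) <;> simp)
    (by
      intro u z _
      -- Two bits determine a conflict: which coordinate of `u` is the label, and which coordinate
      -- of the other neighbour of `z` equals it. That coordinate fixes the colour of the step to
      -- `z`, and the colour fixes the remaining coordinate.
      have : (Set.univ : Set (Bool × Bool)).ncard = 4 := by simp [Set.ncard_univ]
      rw [← this]
      refine Set.ncard_le_ncard_of_injOn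
        (fun e : V × S => (decide (e.1 = u.1.1), decide (e.2.1.1 = e.1))) (fun _ _ => trivial) ?_
      rintro ⟨a, ⟨⟨w1, w2⟩, hw⟩⟩ ⟨⟨k, hk1, hk2⟩, hu, h2⟩ ⟨a', ⟨⟨w1', w2'⟩, hw'⟩⟩
        ⟨⟨k', hk1', hk2'⟩, hu', h2'⟩ heq
      simp only [Prod.mk.injEq, decide_eq_decide] at heq hk1 hk2 hk1' hk2' hu hu' h2 h2'
      obtain ⟨e1, e2⟩ := heq
      have haa : a = a' := by
        by_cases h : a = u.1.1
        · rw [h, e1.1 h]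
        · have h' : a' ≠ u.1.1 := fun h' => h (e1.2 h')
          rw [← hu.resolve_left (fun h'' => h h''.symm), ← hu'.resolve_left (fun h'' => h' h''.symm)]
      subst haa
      by_cases h : w1 = a
      · have h' := e2.1 h
        subst h
        subst h'
        obtain rfl := hk1.colour_unique hk1'
        obtain rfl := hk2.left_unique hk2'
        rfl
      · have h' : w1' ≠ a := fun h' => h (e2.2 h')
        obtain rfl := h2.resolve_left h
        obtain rfl := h2'.resolve_left h'
        obtain rfl := hk2.colour_unique hk2'
        obtain rfl := hk1.left_unique hk1'
        rfl)
    (by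
      intro u z _
      refine (Set.ncard_le_one_iff (Set.toFinite _)).2 ?_
      rintro ⟨⟨k, hk⟩, ⟨⟨w1, w2⟩, hw⟩⟩ ⟨k', ⟨⟨w1', w2'⟩, hw'⟩⟩ ⟨-, h1, h2⟩ ⟨-, h1', h2'⟩
      obtain rfl : k = k' := h1.1.colour_unique h1'.1
      obtain rfl := h2.1.left_unique h2'.1
      obtain rfl := h2.2.left_unique h2'.2
      rfl)
    hℓ hT (by simpa using hcard) (by
      intro w
      refine (hdeg w.1 w.2).trans ?_
      rw [Matrix.relDegree, Nat.cast_le, ← Set.ncard_coe_finset]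
      rw [← Set.ncard_image_of_injective _ Subtype.val_injective]
      refine Set.ncard_le_ncard ?_ (Set.toFinite _)
      rintro p ⟨hp, hr⟩
      exact ⟨⟨p, hp⟩, by simpa using hr, rfl⟩)
  -- The default `x 0` keeps all values in `S`, so the two coordinates differ at every index.
  set g : ℕ → V × V := fun i => if h : i < 2 * ℓ + 1 then (x ⟨i, h⟩).1 else (x 0).1 with hg
  have hgx : ∀ i (h : i < 2 * ℓ + 1), g i = (x ⟨i, h⟩).1 := fun i h => dif_pos h
  have hg0 : g (2 * ℓ) = g 0 := by
    rw [hgx _ (by omega), hgx 0 (by omega)]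
    exact congrArg Subtype.val hx.symm
  have hgr : ∀ i < 2 * ℓ, c.PairRel (g i) (g (i + 1)) := fun i hi => by
    rw [hgx _ (by omega), hgx _ (by omega)]
    exact hstep ⟨i, hi⟩
  have hgne : ∀ i, (g i).1 ≠ (g i).2 := fun i => by
    simp only [hg]
    split_ifs
    exacts [hne _ (x _).2, hne _ (x _).2]
  have hgdisj : ∀ i j, i < j → j < 2 * ℓ → ∀ a, ¬ (((g i).1 = a ∨ (g i).2 = a) ∧
      ((g j).1 = a ∨ (g j).2 = a)) := fun i j hij hj a => by
    rw [hgx _ (by omega), hgx _ (by omega)]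
    exact (hconf ⟨i, by omega⟩ ⟨j, hj⟩ hij).1 a
  obtain ⟨k₀, -⟩ := hgr 0 (by omega)
  have hκ : ∀ i, ∃ k, i < 2 * ℓ →
      c.Rel k (g i).1 (g (i + 1)).1 ∧ c.Rel k (g i).2 (g (i + 1)).2 := fun i => by
    by_cases hi : i < 2 * ℓ
    · obtain ⟨k, hk⟩ := hgr i hi
      exact ⟨k, fun _ => hk⟩
    · exact ⟨k₀, fun h => absurd h hi⟩
  choose κ hκ using hκ
  have hκinj : ∀ i j, i < j → j < 2 * ℓ → κ i ≠ κ j := fun i j hij hj heq => by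
    have h1 := hκ i (hij.trans hj)
    have h2 := hκ j hj
    rw [← heq] at h2
    rw [hgx _ (by omega), hgx _ (by omega)] at h1 h2
    exact (hconf ⟨i, by omega⟩ ⟨j, hj⟩ hij).2
      ⟨κ i, h1.1.mem_usedColours⟩ ⟨h1, h2⟩
  obtain ⟨p, hp1, hp2, hp3, hp4, hp5⟩ := exists_rainbow_cycle_of_rel c (fun i => (g i).1) κ
    (m := 2 * ℓ) (by omega) (fun i hi => (hκ i hi).1) (by rw [hg0])
    (fun i j hij hj heq => hgdisj i j hij hj _ ⟨Or.inl heq, Or.inl rfl⟩) hκinj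
  obtain ⟨q, hq1, hq2, hq3, hq4, hq5⟩ := exists_rainbow_cycle_of_rel c (fun i => (g i).2) κ
    (m := 2 * ℓ) (by omega) (fun i hi => (hκ i hi).2) (by rw [hg0])
    (fun i j hij hj heq => hgdisj i j hij hj _ ⟨Or.inr heq, Or.inr rfl⟩) hκinj
  refine ⟨_, _, p, q, hp1, hp2, hp3, hq1, hq2, hq3, ?_, ?_⟩
  · have hred : ∀ i < 2 * ℓ + 1, ∃ j < 2 * ℓ, g i = g j := fun i hi => by
      rcases Nat.lt_or_ge i (2 * ℓ) with h | h
      · exact ⟨i, h, rfl⟩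
      · exact ⟨0, by omega, by rw [show i = 2 * ℓ by omega, hg0]⟩
    intro a hap haq
    rw [hp4, List.mem_map] at hap
    rw [hq4, List.mem_map] at haq
    obtain ⟨i, hi, rfl⟩ := hap
    obtain ⟨j, hj, hij⟩ := haq
    obtain ⟨i', hi', hii⟩ := hred i (List.mem_range.1 hi)
    obtain ⟨j', hj', hjj⟩ := hred j (List.mem_range.1 hj)
    rw [hii, hjj] at hij
    rcases lt_trichotomy i' j' with h | h | h
    · exact hgdisj i' j' h hj' _ ⟨Or.inl rfl, Or.inr hij⟩
    · subst h
      exact hgne i' hij.symm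
    · exact hgdisj j' i' h hi' _ ⟨Or.inr hij, Or.inl rfl⟩
  · rw [Walk.colourSet, Walk.colourSet, hp5, hq5]

end ProperEdgeColouring

end SimpleGraph

open SimpleGraph SimpleGraph.ProperEdgeColouring in
theorem theorem4p1 (ℓ : ℕ) (hℓ : 2 ≤ ℓ) :
    ∃ C : ℝ, 0 < C ∧
      ∀ (n : ℕ), 1 ≤ n →
      ∀ (V : Type*) [Fintype V] (K : Type*) (G : SimpleGraph V) (c : G.ProperEdgeColouring K),
        Fintype.card V ≤ n →
        c.usedColours.ncard ≤ n →
        C * (n : ℝ) ^ ((3 / 2 : ℝ) + 1 / (ℓ : ℝ)) ≤ (G.edgeSet.ncard : ℝ) →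
        ∃ (u v : V) (p : G.Walk u u) (q : G.Walk v v),
          p.IsCycle ∧ p.length = 2 * ℓ ∧ p.IsRainbow c ∧
          q.IsCycle ∧ q.length = 2 * ℓ ∧ q.IsRainbow c ∧
          p.support.Disjoint q.support ∧
          p.colourSet c = q.colourSet c := by
  have hℓ1 : (1 : ℝ) ≤ ℓ := by exact_mod_cast (by omega : 1 ≤ ℓ)
  -- The square of this constant is the factor of `T` in the minimum degree condition for the
  -- conflict-free walk.
  refine ⟨100 * (ℓ : ℝ) ^ 2, by positivity, fun n hn V _ K G c hV hK he => ?_⟩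
  classical
  set C : ℝ := 100 * (ℓ : ℝ) ^ 2 with hC
  have hC1 : 1 ≤ C := by nlinarith
  have hn1 : (1 : ℝ) ≤ n := by exact_mod_cast hn
  have hn0 : (0 : ℝ) < n := by linarith
  set P : ℝ := (n : ℝ) ^ ((3 / 2 : ℝ) + 1 / (ℓ : ℝ)) with hP
  set T : ℝ := (n : ℝ) ^ (2 / (ℓ : ℝ)) with hT
  have hT0 : 0 < T := Real.rpow_pos_of_pos hn0 _
  have hTℓ : T ^ ℓ = (n : ℝ) ^ 2 := by
    rw [hT, ← Real.rpow_natCast, ← Real.rpow_mul hn0.le, div_mul_cancel₀ _ (by positivity),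
      Real.rpow_two]
  have hPP : P ^ 2 = (n : ℝ) ^ 3 * T := by
    rw [hP, hT, ← Real.rpow_natCast, ← Real.rpow_mul hn0.le, ← Real.rpow_natCast (n : ℝ) 3,
      ← Real.rpow_add hn0]
    congr 1
    push_cast
    ring
  have hPn : (n : ℝ) ≤ P := by
    calc (n : ℝ) = (n : ℝ) ^ (1 : ℝ) := (Real.rpow_one _).symm
      _ ≤ P := Real.rpow_le_rpow_of_exponent_le hn1 (by
        have : 0 ≤ 1 / (ℓ : ℝ) := by positivity
        linarith)
  obtain ⟨D, hD, hcs⟩ := exists_sq_le_card_pairRel c hK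
  have hDe : 2 * (C * P) ≤ D := by linarith
  set S₀ : Finset (V × V) := (univ : Finset V).offDiag with hS₀
  set E : ℕ := ((S₀ ×ˢ S₀).filter fun e => c.PairRel e.1 e.2).card with hE
  have hE2 : 2 * (C ^ 2 * T) * (n : ℝ) ^ 2 ≤ E := by
    have hCP : (n : ℝ) ≤ C * P := hPn.trans (le_mul_of_one_le_left (by linarith) hC1)
    have h3 : 2 * (C * P) * (C * P) ≤ n * E := by
      -- This is monotonicity of `D ^ 2 - n * D` from `2 * (C * P)` upwards; `n ≤ C * P` then
      -- absorbs the linear term of `hcs`.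
      have : 0 ≤ (D - 2 * (C * P)) * (D + 2 * (C * P) - n) := by
        apply mul_nonneg <;> nlinarith
      nlinarith
    have h4 : 2 * (C * P) * (C * P) = n * (2 * (C ^ 2 * T) * (n : ℝ) ^ 2) := by
      linear_combination 2 * C ^ 2 * hPP
    rw [h4] at h3
    exact le_of_mul_le_mul_left h3 hn0
  have hScard : (S₀.card : ℝ) ≤ (n : ℝ) ^ 2 := by
    have h1 : S₀.card ≤ n ^ 2 := by
      calc S₀.card ≤ Fintype.card (V × V) := card_le_univ _
        _ = Fintype.card V ^ 2 := by rw [Fintype.card_prod, sq]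
        _ ≤ n ^ 2 := Nat.pow_le_pow_left hV 2
    exact_mod_cast h1
  have hS₀ne : S₀.Nonempty := by
    by_contra h
    rw [not_nonempty_iff_eq_empty] at h
    have h0 : (E : ℝ) = 0 := by rw [hE, h]; simp
    have : 0 < 2 * (C ^ 2 * T) * (n : ℝ) ^ 2 := by positivity
    linarith
  obtain ⟨S, hSS, hSne, hSdeg⟩ := exists_subset_forall_le_card_filter
    (r := c.PairRel) (fun _ _ h => h.symm) hS₀ne (d := C ^ 2 * T) (by
      refine le_trans (mul_le_mul_of_nonneg_left hScard (by positivity)) (hE2.trans_eq ?_)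
      rw [hE])
  refine exists_cycles_of_le_card_filter_pairRel c (by omega) hSne
    (fun p hp => (mem_offDiag.1 (hSS hp)).2.2) hT0 ?_ (fun p hp => ?_)
  · rw [hTℓ]
    exact le_trans (by exact_mod_cast card_le_card hSS) hScard
  · refine (hSdeg p hp).trans_eq ?_
    rw [← Set.ncard_coe_finset, coe_filter]
    rfl
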